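/- **Theorem 3 (Statistical Back-Propagation).** Let $z=(z_v)_{v\in V}$ be finitely many scalar random variables, arranged in a directed acyclic graphical model with scalar parameters $\phi=(\phi_k)_{k}$: $$q_\phi(z)=\prod_{v} q_\phi(z_v\mid pa(z_v)),$$ where $pa(z_v)$ consists of the parameters and variables that are parents of $z_v$, and each $q_\phi(z_v\mid pa(z_v))$ is a conditional density on a fixed open interval (continuous $z_v$) or a conditional probability mass function on $\{0,1,2,\dots\}$ (discrete $z_v$; a finite alphabet has mass zero beyond its last letter). Internal variables, i.e. those with at least one child variable, are continuous; leaf variables, i.e. those without child variables, are continuous or discrete. For a variable $z_v$ write $Q_\phi(z_v\mid pa(z_v))$ for the conditional CDF, and, for a parameter or variable $s$, $ch(s)$ for the set of variables that have $s$ as a parent. Define the variable-nabla $$g_s^{q_\phi(z_v\mid pa(z_v))}=\frac{-1}{q_\phi(z_v\mid pa(z_v))}\,\nabla_s Q_\phi(z_v\mid pa(z_v)),$$ and, for a real function $f(z)$ of all the variables, $\mathbb D_{z_v}f=\partial f/\partial z_v$ if $z_v$ is continuous and $\mathbb D_{z_v}f=f(z_{-v},z_v+1)-f(z)$ if $z_v$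 is discrete. Define $\mathbb{BP}$ recursively, from the leaves back, by $$\mathbb{BP}[z_v]=\mathbb D_{z_v}f+\sum_{z_w\in ch(z_v)} g_{z_v}^{q_\phi(z_w\mid pa(z_w))}\,\mathbb{BP}[z_w].$$ Thus $\mathbb{BP}[z_v]=\mathbb D_{z_v} f$ at a leaf, and the term $\mathbb D_{z_v}f$ is absent at an internal variable on which $f$ does not depend directly. Fix a parameter point $\phi$ and an index $k$ such that the model is defined for all values of $\phi_k$ near the given one. A path is a directed path $\phi_k\to z_{v_1}\to\dots\to z_{v_m}$, $m\ge 1$. Assume that the variable-nablas are accessible: for each edge $s\to z_v$ on a path, and almost every $z$, $Q_\phi(z_v\mid pa(z_v))$ and $q_\phi(z_v\mid pa(z_v))$ are differentiable in $s$, and $\nabla_sQ_\phi=0$ where $q_\phi=0$; and $q_\phi(z_v\mid pa(z_v))$ is locally Lipschitz in $s$, locally uniformly in $z_v$. Assume the following of the measurable function $f$. 1. $f$ is locally Lipschitz in each continuous variable, and $\mathbb E_{q_\phi}|f|<\infty$. 2. On a neighbourhood of the given $\phi_k$, the map $\phi_k\mapsto f(z)q_\phi(z)$ is, for almost every $z$,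 Lipschitz with a constant $b(z)$, where $b$ is integrable. 3. For each path from $\phi_k$ to $z_v$, the product of the variable-nablas along the path and $\mathbb D_{z_v}f$ is integrable with respect to $q_\phi$. 4. For each path from $\phi_k$ to $z_v$ with last edge $s\to z_v$, the product of $f$, of the variable-nablas along the path without its last edge, and of $\nabla_s q_\phi(z_v\mid pa(z_v))\prod_{w\ne v}q_\phi(z_w\mid pa(z_w))$ is integrable with respect to the product of the Lebesgue and counting measures. 5. For each such edge $s\to z_v$, the function $f\cdot\nabla_sQ_\phi(z_v\mid pa(z_v))\prod_{z_w\in ch(z_v)}q_\phi(z_w\mid pa(z_w))$ tends to zero as $z_v$ tends to either end of its interval (continuous) or to $\infty$ (discrete), for almost every value of the other variables. Then $\phi_k\mapsto\mathbb E_{q_\phi}[f]$ is differentiable at the given point, and $$\nabla_{\phi_k}\mathbb E_{q_\phi(z)}[f(z)]=\mathbb E_{q_\phi(z)}\Big[\sum_{z_v\in ch(\phi_k)} g_{\phi_k}^{q_\phi(z_v\mid pa(z_v))}\,\mathbb{BP}[z_v]\Big],$$ where the function inside the expectation on the right is integrable. -/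

import Mathlib

open MeasureTheory Filter Topology
open scoped NNReal ENNReal

/-- The type of a scalar random variable: continuous with values in an open interval `S`
(bounded or unbounded), or discrete with values in `{0, 1, 2, …}`. A finite alphabet
`{0, …, N}` is the discrete case with probability zero beyond `N`. -/
inductive VarType : Type
  | continuous (S : Set ℝ) (isOpen : IsOpen S) (ordConnected : S.OrdConnected)
      (nonempty : S.Nonempty) : VarType
  | discrete : VarType

namespace VarType

/-- The set of values of the variable. -/
def support : VarType → Set ℝ
  | continuous S _ _ _ => S
  | discrete => Set.range (Nat.cast : ℕ → ℝ)

/-- The reference measure for densities: Lebesgue measure, or counting measure on `ℕ`. -/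
noncomputable def refMeasure : VarType → Measure ℝ
  | continuous S _ _ _ => volume.restrict S
  | discrete => Measure.sum fun n : ℕ => Measure.dirac (n : ℝ)

/-- `F` tends to zero at both ends of the interval (continuous), or at infinity (discrete). -/
def VanishesAtEnds (F : ℝ → ℝ) : VarType → Prop
  | continuous S _ _ _ =>
      Tendsto (fun t : S => F t) atTop (𝓝 0) ∧ Tendsto (fun t : S => F t) atBot (𝓝 0)
  | discrete => Tendsto (fun n : ℕ => F n) atTop (𝓝 0)

end VarType

/-- A hierarchical directed acyclic graphical model over scalar variables `z_v`, `v : V`, with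
scalar parameters `φ_k`, `k : K`. A joint configuration of parameters and variables is a function
`x : K ⊕ V → ℝ`; `q v x` is the conditional density (probability mass, if discrete)
`q_φ(z_v | pa(z_v))`. -/
structure GraphicalModel (V K : Type*) [DecidableEq V] where
  /-- Type of each variable. -/
  type : V → VarType
  /-- The parents of `z_v`: parameters and variables. -/
  pa : V → Finset (K ⊕ V)
  /-- The directed graph on the variables has no directed cycle. -/
  acyclic : ∀ v, ¬ Relation.TransGen (fun u w => Sum.inr u ∈ pa w) v v
  /-- Internal variables, i.e. those with a child, are continuous. -/
  internal_continuous : ∀ u w, Sum.inr u ∈ pa w → type u ≠ VarType.discrete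
  /-- The set of admissible parameters. -/
  Θ : Set (K → ℝ)
  /-- The conditional densities. -/
  q : V → (K ⊕ V → ℝ) → ℝ
  /-- `q_φ(z_v | pa(z_v))` depends only on `z_v` and its parents. -/
  q_local : ∀ v x y, x (Sum.inr v) = y (Sum.inr v) → (∀ s ∈ pa v, x s = y s) → q v x = q v y
  /-- Measurability. -/
  q_measurable : ∀ v, ∀ φ ∈ Θ, Measurable fun z : V → ℝ => q v (Sum.elim φ z)
  /-- Nonnegativity. -/
  q_nonneg : ∀ v, ∀ φ ∈ Θ, ∀ z : V → ℝ, (∀ u, z u ∈ (type u).support) → 0 ≤ q v (Sum.elim φ z)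
  /-- Normalization: each conditional distribution has total mass one. -/
  q_normalized : ∀ v, ∀ φ ∈ Θ, ∀ z : V → ℝ, (∀ u, z u ∈ (type u).support) →
    ∫⁻ t, ENNReal.ofReal (q v (Sum.elim φ (Function.update z v t))) ∂(type v).refMeasure = 1

namespace GraphicalModel

variable {V K : Type*} [DecidableEq V] [Fintype V] [DecidableEq K]

/-- The children variables of a parameter or of a variable. -/
def ch (M : GraphicalModel V K) (s : K ⊕ V) : Finset V :=
  Finset.univ.filter fun w => s ∈ M.pa w

/-- The product of the reference measures. -/
noncomputable def base (M : GraphicalModel V K) : Measure (V → ℝ) :=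
  Measure.pi fun v => (M.type v).refMeasure

/-- The joint density `q_φ(z) = ∏_v q_φ(z_v | pa(z_v))`. -/
noncomputable def density (M : GraphicalModel V K) (φ : K → ℝ) (z : V → ℝ) : ℝ :=
  ∏ v, M.q v (Sum.elim φ z)

/-- The joint distribution of all the variables. -/
noncomputable def law (M : GraphicalModel V K) (φ : K → ℝ) : Measure (V → ℝ) :=
  M.base.withDensity fun z => ENNReal.ofReal (M.density φ z)

/-- The conditional cumulative distribution function `Q_φ(z_v | pa(z_v))`. -/
noncomputable def Q (M : GraphicalModel V K) (v : V) (x : K ⊕ V → ℝ) : ℝ :=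
  ∫ t in Set.Iic (x (Sum.inr v)), M.q v (Function.update x (Sum.inr v) t) ∂(M.type v).refMeasure

/-- Partial derivative of a function of the joint configuration in the coordinate `s`. -/
noncomputable def partialD (s : K ⊕ V) (h : (K ⊕ V → ℝ) → ℝ) (x : K ⊕ V → ℝ) : ℝ :=
  deriv (fun a => h (Function.update x s a)) (x s)

/-- The variable-nabla `g_s^{q(z_v | pa(z_v))} = - ∇_s Q(z_v | pa(z_v)) / q(z_v | pa(z_v))`, where
`s` is a parameter or a variable. -/
noncomputable def nabla (M : GraphicalModel V K) (s : K ⊕ V) (v : V) (x : K ⊕ V → ℝ) : ℝ :=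
  -1 / M.q v x * partialD s (M.Q v) x

/-- The operator `D_{z_v}`: partial derivative if `z_v` is continuous, forward difference if it is
discrete. -/
noncomputable def D (M : GraphicalModel V K) (v : V) (f : (V → ℝ) → ℝ) (z : V → ℝ) : ℝ :=
  match M.type v with
  | VarType.continuous _ _ _ _ => deriv (fun t => f (Function.update z v t)) (z v)
  | VarType.discrete => f (Function.update z v (z v + 1)) - f z

/-- The recursion that defines `BP` terminates. -/
theorem wellFounded_child (M : GraphicalModel V K) :
    WellFounded fun w v : V => w ∈ M.ch (Sum.inr v) := by
  have : IsStrictOrder V (Relation.TransGen fun w v : V => w ∈ M.ch (Sum.inr v)) :=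
    { irrefl := fun v h => M.acyclic v (by
        have h' := Relation.transGen_swap.mpr h
        simpa [ch, Function.swap] using h')
      trans := fun _ _ _ => Relation.TransGen.trans }
  exact Subrelation.wf (fun h => Relation.TransGen.single h) (Finite.wellFounded_of_trans_of_irrefl
    (Relation.TransGen fun w v : V => w ∈ M.ch (Sum.inr v)))

/-- The back-propagated quantity `BP[z_v]`. The objective `f` counts as one more child of every
variable, with `BP[f] = 1` and variable-nabla `D_{z_v} f`; hence
`BP[z_v] = D_{z_v} f + ∑_{w ∈ ch(z_v)} g_{z_v}^{q(z_w | pa(z_w))} BP[z_w]`, and `f` is the only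
child of a leaf. -/
noncomputable def BP (M : GraphicalModel V K) (f : (V → ℝ) → ℝ) (φ : K → ℝ) (z : V → ℝ) : V → ℝ :=
  M.wellFounded_child.fix fun v rec =>
    M.D v f z + ∑ w : {w // w ∈ M.ch (Sum.inr v)},
      M.nabla (Sum.inr v) w (Sum.elim φ z) * rec w w.2

/-- The recursion for `BP`. -/
theorem BP_eq (M : GraphicalModel V K) (f : (V → ℝ) → ℝ) (φ : K → ℝ) (z : V → ℝ) (v : V) :
    M.BP f φ z v = M.D v f z +
      ∑ w ∈ M.ch (Sum.inr v), M.nabla (Sum.inr v) w (Sum.elim φ z) * M.BP f φ z w := by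
  rw [BP, WellFounded.fix_eq]
  congr 1
  exact Finset.sum_coe_sort (M.ch (Sum.inr v))
    fun w => M.nabla (Sum.inr v) w (Sum.elim φ z) * M.BP f φ z w

/-- At a leaf, `BP[z_v] = D_{z_v} f`. -/
theorem BP_leaf (M : GraphicalModel V K) (f : (V → ℝ) → ℝ) (φ : K → ℝ) (z : V → ℝ) (v : V)
    (hv : M.ch (Sum.inr v) = ∅) : M.BP f φ z v = M.D v f z := by
  rw [BP_eq, hv, Finset.sum_empty, add_zero]

/-- At an internal variable on which `f` does not depend directly,
`BP[z_v] = ∑_{w ∈ ch(z_v)} g_{z_v}^{q(z_w | pa(z_w))} BP[z_w]`. -/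
theorem BP_internal (M : GraphicalModel V K) (f : (V → ℝ) → ℝ) (φ : K → ℝ) (z : V → ℝ) (v : V)
    (hf : ∀ t, f (Function.update z v t) = f z) :
    M.BP f φ z v =
      ∑ w ∈ M.ch (Sum.inr v), M.nabla (Sum.inr v) w (Sum.elim φ z) * M.BP f φ z w := by
  have h : M.D v f z = 0 := by
    unfold D
    split <;> simp [hf]
  rw [BP_eq, h, zero_add]

/-- The end point of the directed path that starts at the parameter `φ_k` and then visits the
variables in the list, most recent first. -/
def tip (k : K) : List V → K ⊕ V
  | [] => Sum.inl k
  | v :: _ => Sum.inr v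

/-- The list is a directed path that starts at `φ_k`. -/
def IsPath (M : GraphicalModel V K) (k : K) : List V → Prop
  | [] => True
  | v :: p => tip k p ∈ M.pa v ∧ M.IsPath k p

/-- The product of the variable-nablas along the edges of the path. -/
noncomputable def pathNabla (M : GraphicalModel V K) (k : K) (x : K ⊕ V → ℝ) : List V → ℝ
  | [] => 1
  | v :: p => M.nabla (tip k p) v x * M.pathNabla k x p

/-- The variable-nablas along the paths from `φ_k` are accessible at `φ`. For each edge `s → v` on
such a path: the conditional CDF is differentiable in `s`, and so is the conditional density,
almost everywhere; the quotient `∇_s Q / q` makes sense, i.e. `∇_s Q = 0` where `q = 0`; and `q` is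
Lipschitz in `s`, locally uniformly in the value of `z_v`. -/
structure HasNablas (M : GraphicalModel V K) (φ : K → ℝ) (k : K) : Prop where
  differentiable_cdf : ∀ p v, M.IsPath k (v :: p) → ∀ᵐ z ∂M.base,
    DifferentiableAt ℝ (fun a => M.Q v (Function.update (Sum.elim φ z) (tip k p) a))
      (Sum.elim φ z (tip k p))
  differentiable_density : ∀ p v, M.IsPath k (v :: p) → ∀ᵐ z ∂M.base,
    DifferentiableAt ℝ (fun a => M.q v (Function.update (Sum.elim φ z) (tip k p) a))
      (Sum.elim φ z (tip k p))
  quotient : ∀ p v, M.IsPath k (v :: p) → ∀ᵐ z ∂M.base,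
    M.q v (Sum.elim φ z) = 0 → partialD (tip k p) (M.Q v) (Sum.elim φ z) = 0
  lipschitz : ∀ p v, M.IsPath k (v :: p) →
    ∀ z : V → ℝ, (∀ u, z u ∈ (M.type u).support) →
      ∃ C : ℝ≥0, ∃ U ∈ 𝓝 (Sum.elim φ z (tip k p)), ∃ W ∈ 𝓝 (z v),
        ∀ y ∈ W ∩ (M.type v).support, LipschitzOnWith C
          (fun a => M.q v (Function.update (Sum.elim φ (Function.update z v y)) (tip k p) a)) U

/-- Regularity, integrability and growth conditions on the objective `f`, for the derivative in
`φ_k` at `φ`. -/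
structure Admissible (M : GraphicalModel V K) (f : (V → ℝ) → ℝ) (φ : K → ℝ) (k : K) : Prop where
  measurable : Measurable f
  /-- `f` is locally Lipschitz in each continuous variable. -/
  locallyLipschitz : ∀ v, M.type v ≠ VarType.discrete →
    ∀ z : V → ℝ, (∀ u, z u ∈ (M.type u).support) →
      LocallyLipschitzOn (M.type v).support fun t => f (Function.update z v t)
  /-- `E_q[f]` exists. -/
  integrable : Integrable f (M.law φ)
  /-- Domination of `f(z) q_φ(z)` for parameters `φ_k` near the given one. -/
  dominated : ∃ ε > 0, ∃ b : (V → ℝ) → ℝ, Integrable b M.base ∧ ∀ᵐ z ∂M.base,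
    LipschitzOnWith (Real.nnabs (b z))
      (fun t => f z * M.density (Function.update φ k t) z) (Metric.ball (φ k) ε)
  /-- For every path from `φ_k` to `z_v`, the product of the variable-nablas along the path and
  `D_{z_v} f` is integrable. -/
  integrable_nabla : ∀ p v, M.IsPath k (v :: p) →
    Integrable (fun z => M.pathNabla k (Sum.elim φ z) (v :: p) * M.D v f z) (M.law φ)
  /-- For every path from `φ_k` with last edge `s → v`, the product of `f`, of the variable-nablas
  along the path without its last edge, and of `∇_s q(z_v | pa(z_v)) ∏_{w ≠ v} q(z_w | pa(z_w))`
  is integrable. -/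
  integrable_score : ∀ p v, M.IsPath k (v :: p) →
    Integrable (fun z => f z * M.pathNabla k (Sum.elim φ z) p *
      (partialD (tip k p) (M.q v) (Sum.elim φ z) *
        ∏ w ∈ Finset.univ.erase v, M.q w (Sum.elim φ z))) M.base
  /-- `f` does not grow faster than `∇_s Q(z_v | pa(z_v)) ∏_{w ∈ ch(z_v)} q(z_w | pa(z_w))` tends to
  zero at the ends of the range of `z_v`, for each edge `s → v` on a path from `φ_k`. -/
  boundary : ∀ p v, M.IsPath k (v :: p) → ∀ᵐ z ∂M.base,
    (M.type v).VanishesAtEnds fun t =>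
      f (Function.update z v t) *
        partialD (tip k p) (M.Q v) (Sum.elim φ (Function.update z v t)) *
        ∏ w ∈ M.ch (Sum.inr v), M.q w (Sum.elim φ (Function.update z v t))

end GraphicalModel

/-! Differentiating under the integral sign gives one term for each child `v` of `φ_k`: the integral
of `f · ∇q_v · ∏_{w ≠ v} q_w`, which is `score` for a path with a single edge. Each such term is
integrated by parts in its own variable `z_v`. For an edge `s → v`, `∇_s q_v` is the
`z_v`-derivative (backward difference, if discrete) of `∇_s Q_v`, and `-∇_s Q_v = g · q_v` restores
the missing factor of the joint density. The derivative in `z_v` then falls on `f`, giving `E[g ·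
D_v f]`, or on the density `q_w` of a child `w` of `v`, giving a score term for the path extended by
`v → w`. No other factor moves: the remaining densities do not involve `z_v`, and by acyclicity
neither do the nablas of earlier edges. This is `integral_score`; boundary terms vanish by the decay
hypothesis.

Well-founded induction from the leaves (`integral_score_eq_integral_BP`) sums these contributions
over all extensions of a path, which is exactly the recursion for `BP`. Since `BP` unfolds into a
sum over paths, integrability path by path suffices.

The analytic core is `integral_parts_eq_zero`. In the continuous case the local Lipschitz bounds
make `∇_s Q_v` a primitive of `∇_s q_v` and make the full product absolutely continuous on compact
subintervals, so the fundamental theorem of calculus applies. A discrete variable is a leaf, so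
summation by parts with two factors is enough. -/

set_option linter.unusedSectionVars false

/-! ### Parameter derivatives of distribution functions and integration by parts on an interval -/

/-- A family of functions that is Lipschitz in the parameter near `s₀`, locally uniformly in the
second variable, is so uniformly on compact sets. -/
theorem exists_lipschitzOnWith_of_isCompact {S K : Set ℝ} {q : ℝ → ℝ → ℝ} {s₀ : ℝ}
    (hlip : ∀ y ∈ S, ∃ C : ℝ≥0, ∃ U ∈ 𝓝 s₀, ∃ W ∈ 𝓝 y, ∀ y' ∈ W ∩ S,
      LipschitzOnWith C (fun a => q a y') U)
    (hK : IsCompact K) (hKS : K ⊆ S) :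
    ∃ C : ℝ≥0, ∃ U ∈ 𝓝 s₀, ∀ y ∈ K, LipschitzOnWith C (fun a => q a y) U := by
  -- Compactness induction passes through sets that need not lie in `S`, so the claim is weakened to
  -- the points of `S`.
  suffices h : ∃ C : ℝ≥0, ∃ U ∈ 𝓝 s₀, ∀ y ∈ K ∩ S, LipschitzOnWith C (fun a => q a y) U by
    rwa [Set.inter_eq_left.mpr hKS] at h
  refine hK.induction_on
    (p := fun K => ∃ C : ℝ≥0, ∃ U ∈ 𝓝 s₀, ∀ y ∈ K ∩ S, LipschitzOnWith C (fun a => q a y) U)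
    ⟨0, Set.univ, univ_mem, by simp⟩ ?_ ?_ ?_
  · rintro A B hAB ⟨C, U, hU, h⟩
    exact ⟨C, U, hU, fun y hy => h y ⟨hAB hy.1, hy.2⟩⟩
  · rintro A B ⟨C, U, hU, h⟩ ⟨C', U', hU', h'⟩
    refine ⟨max C C', U ∩ U', inter_mem hU hU', ?_⟩
    rintro y ⟨hy | hy, hyS⟩
    · exact ((h y ⟨hy, hyS⟩).mono Set.inter_subset_left).weaken (le_max_left _ _)
    · exact ((h' y ⟨hy, hyS⟩).mono Set.inter_subset_right).weaken (le_max_right _ _)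
  · intro y hy
    obtain ⟨C, U, hU, W, hW, h⟩ := hlip y (hKS hy)
    exact ⟨W, mem_nhdsWithin_of_mem_nhds hW, C, U, hU, h⟩

/-- Differentiation under the integral sign over a compact subinterval. -/
theorem hasDerivAt_intervalIntegral_of_locally_lipschitz {S : Set ℝ} [S.OrdConnected]
    {q : ℝ → ℝ → ℝ} {s₀ : ℝ}
    (hint : ∀ᶠ a in 𝓝 s₀, IntegrableOn (q a) S)
    (hlip : ∀ y ∈ S, ∃ C : ℝ≥0, ∃ U ∈ 𝓝 s₀, ∃ W ∈ 𝓝 y, ∀ y' ∈ W ∩ S,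
      LipschitzOnWith C (fun a => q a y') U)
    (hdiff : ∀ᵐ t ∂volume.restrict S, DifferentiableAt ℝ (fun a => q a t) s₀)
    {a b : ℝ} (ha : a ∈ S) (hb : b ∈ S) :
    IntervalIntegrable (fun t => deriv (fun s => q s t) s₀) volume a b ∧
      HasDerivAt (fun s => ∫ t in a..b, q s t) (∫ t in a..b, deriv (fun s => q s t) s₀) s₀ := by
  have hsub : Set.uIcc a b ⊆ S := Set.OrdConnected.uIcc_subset ‹_› ha hb
  have hsub' : Set.uIoc a b ⊆ S := Set.uIoc_subset_uIcc.trans hsub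
  obtain ⟨C, U, hU, hC⟩ := exists_lipschitzOnWith_of_isCompact hlip isCompact_uIcc hsub
  have hd : ∀ᵐ t ∂volume.restrict (Set.uIoc a b), DifferentiableAt ℝ (fun a => q a t) s₀ :=
    ae_restrict_of_ae_restrict_of_subset hsub' hdiff
  refine intervalIntegral.hasDerivAt_integral_of_dominated_loc_of_lip (bound := fun _ => (C : ℝ))
    hU ?_ ?_ ?_ ?_ intervalIntegrable_const ?_
  · filter_upwards [hint] with s hs
    exact (hs.mono_set hsub').aestronglyMeasurable
  · exact intervalIntegrable_iff.mpr (hint.self_of_nhds.mono_set hsub')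
  -- The derivative is measurable as an a.e. limit of difference quotients along a sequence `u n →
  -- s₀`, `u n ≠ s₀`, chosen so that every `q (u n)` is integrable.
  · have hfreq : ∃ᶠ s in 𝓝[≠] s₀, IntegrableOn (q s) S :=
      (hint.filter_mono nhdsWithin_le_nhds).frequently
    obtain ⟨u, hu, hu'⟩ := exists_seq_forall_of_frequently hfreq
    refine aestronglyMeasurable_of_tendsto_ae atTop
      (f := fun n t => slope (fun s => q s t) s₀ (u n)) (fun n => ?_) ?_
    · simp only [slope_def_field]
      exact ((((hu' n).mono_set hsub').sub
        (hint.self_of_nhds.mono_set hsub')).div_const _).aestronglyMeasurable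
    · filter_upwards [hd] with t ht
      exact (hasDerivAt_iff_tendsto_slope.mp ht.hasDerivAt).comp hu
  · refine ae_of_all _ fun t ht => ?_
    simpa using! hC t (Set.uIoc_subset_uIcc ht)
  · rw [← ae_restrict_iff' measurableSet_uIoc]
    filter_upwards [hd] with t ht using ht.hasDerivAt

/-- The increments of the parameter derivative of a distribution function are the integrals of the
parameter derivative of the density. -/
theorem deriv_cdf_sub_deriv_cdf {S : Set ℝ} [S.OrdConnected] (hS : IsOpen S)
    {q : ℝ → ℝ → ℝ} {s₀ : ℝ}
    (hint : ∀ᶠ a in 𝓝 s₀, IntegrableOn (q a) S)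
    (hlip : ∀ y ∈ S, ∃ C : ℝ≥0, ∃ U ∈ 𝓝 s₀, ∃ W ∈ 𝓝 y, ∀ y' ∈ W ∩ S,
      LipschitzOnWith C (fun a => q a y') U)
    (hdiff : ∀ᵐ t ∂volume.restrict S, DifferentiableAt ℝ (fun a => q a t) s₀)
    (hcdf : ∀ᵐ t ∂volume.restrict S,
      DifferentiableAt ℝ (fun a => ∫ x in Set.Iic t, q a x ∂volume.restrict S) s₀)
    {a b : ℝ} (ha : a ∈ S) (hb : b ∈ S) :
    deriv (fun s => ∫ x in Set.Iic b, q s x ∂volume.restrict S) s₀ -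
      deriv (fun s => ∫ x in Set.Iic a, q s x ∂volume.restrict S) s₀ =
      ∫ t in a..b, deriv (fun s => q s t) s₀ := by
  have hne : (volume.restrict S) ≠ 0 := by
    rw [Ne, Measure.restrict_eq_zero]
    exact (hS.measure_pos volume ⟨a, ha⟩).ne'
  have : (ae (volume.restrict S)).NeBot := ae_neBot.mpr hne
  -- Differentiability of the distribution function is known only almost everywhere. One good point
  -- `t₀` gives it at every `t ∈ S`, because the increment from `t₀` to `t` is an integral over a
  -- compact interval.
  obtain ⟨t₀, ht₀, ht₀S⟩ := (hcdf.and (ae_restrict_mem hS.measurableSet)).exists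
  have key : ∀ t ∈ S, HasDerivAt (fun s => ∫ x in Set.Iic t, q s x ∂volume.restrict S)
      (deriv (fun s => ∫ x in Set.Iic t₀, q s x ∂volume.restrict S) s₀ +
        ∫ x in t₀..t, deriv (fun s => q s x) s₀) s₀ := by
    intro t ht
    refine (ht₀.hasDerivAt.add (hasDerivAt_intervalIntegral_of_locally_lipschitz hint hlip hdiff
      ht₀S ht).2).congr_of_eventuallyEq ?_
    filter_upwards [hint] with s hs
    have hs' : Integrable (q s) (volume.restrict S) := hs
    have h1 := intervalIntegral.integral_Iic_sub_Iic (a := t₀) (b := t)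
      hs'.integrableOn hs'.integrableOn
    have h2 : ∫ x in t₀..t, q s x ∂volume.restrict S = ∫ x in t₀..t, q s x := by
      have hsub : ∀ {c d}, c ∈ S → d ∈ S → Set.Ioc c d ⊆ S := fun hc hd =>
        Set.Ioc_subset_Icc_self.trans (Set.OrdConnected.out ‹_› hc hd)
      simp only [intervalIntegral, Measure.restrict_restrict measurableSet_Ioc,
        Set.inter_eq_left.mpr (hsub ht₀S ht), Set.inter_eq_left.mpr (hsub ht ht₀S)]
    simp only [Pi.add_apply]
    rw [← h2, ← h1]
    ring
  have hi := fun {c d} (hc : c ∈ S) (hd : d ∈ S) =>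
    (hasDerivAt_intervalIntegral_of_locally_lipschitz hint hlip hdiff hc hd).1
  rw [(key b hb).deriv, (key a ha).deriv,
    ← intervalIntegral.integral_interval_sub_left (hi ht₀S hb) (hi ht₀S ha)]
  ring

/-- An integrable function on an open interval integrates to zero if it is the increment of a
function that vanishes at both ends. -/
theorem integral_eq_zero_of_vanishes_at_ends {S : Set ℝ} [hS' : S.OrdConnected] (hS : IsOpen S)
    (hne : S.Nonempty) {H h : ℝ → ℝ} (hint : IntegrableOn h S)
    (hH : ∀ a ∈ S, ∀ b ∈ S, a ≤ b → ∫ t in a..b, h t = H b - H a)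
    (htop : Tendsto (fun t : S => H t) atTop (𝓝 0)) (hbot : Tendsto (fun t : S => H t) atBot (𝓝 0)) :
    ∫ t in S, h t = 0 := by
  have := hne.to_subtype
  have hcov : AECover (volume.restrict S) ((atBot : Filter S) ×ˢ (atTop : Filter S))
      fun p => Set.Ioc (p.1 : ℝ) p.2 := by
    refine ⟨?_, fun _ => measurableSet_Ioc⟩
    filter_upwards [ae_restrict_mem hS.measurableSet] with x hx
    obtain ⟨l, hl, hlx⟩ : ∃ l ∈ S, l < x := by
      obtain ⟨l, hl, h⟩ := exists_Ioc_subset_of_mem_nhds (hS.mem_nhds hx) (exists_lt x)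
      exact ⟨(l + x) / 2, h ⟨by linarith, by linarith⟩, by linarith⟩
    have h1 := (eventually_le_atBot (⟨l, hl⟩ : S)).prod_inl (atTop : Filter S)
    have h2 := (eventually_ge_atTop (⟨x, hx⟩ : S)).prod_inr (atBot : Filter S)
    filter_upwards [h1, h2] with p hp1 hp2
    exact ⟨lt_of_le_of_lt hp1 hlx, hp2⟩
  have hlim := hcov.integral_tendsto_of_countably_generated (f := h) hint
  have hlim' : Tendsto (fun p : S × S => H p.2 - H p.1) ((atBot : Filter S) ×ˢ (atTop : Filter S))
      (𝓝 0) := by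
    simpa using (htop.comp tendsto_snd).sub (hbot.comp tendsto_fst)
  refine tendsto_nhds_unique hlim (hlim'.congr' ?_)
  obtain ⟨x, hx⟩ := hne
  have h1 := (eventually_le_atBot (⟨x, hx⟩ : S)).prod_inl (atTop : Filter S)
  have h2 := (eventually_ge_atTop (⟨x, hx⟩ : S)).prod_inr (atBot : Filter S)
  filter_upwards [h1, h2] with p hp1 hp2
  have hle : (p.1 : ℝ) ≤ p.2 := (show (p.1 : ℝ) ≤ x from hp1).trans hp2
  rw [← hH _ p.1.2 _ p.2.2 hle, intervalIntegral.integral_of_le hle,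
    Measure.restrict_restrict measurableSet_Ioc, Set.inter_eq_left.mpr
      (Set.Ioc_subset_Icc_self.trans (hS'.out p.1.2 p.2.2))]

theorem AbsolutelyContinuousOnInterval.prod {ι : Type*} {a b : ℝ} (s : Finset ι) {r : ι → ℝ → ℝ}
    (h : ∀ i ∈ s, AbsolutelyContinuousOnInterval (r i) a b) :
    AbsolutelyContinuousOnInterval (fun t => ∏ i ∈ s, r i t) a b := by
  classical
  induction s using Finset.induction_on with
  | empty =>
    simp only [Finset.prod_empty]
    exact ((LipschitzWith.const (1 : ℝ)).lipschitzOnWith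
      (s := Set.uIcc a b)).absolutelyContinuousOnInterval
  | insert i s hi ih =>
    simp only [Finset.prod_insert hi]
    exact (h i (by simp)).fun_mul (ih fun j hj => h j (by simp [hj]))

/-- Integration by parts on an open interval, for the product of a locally Lipschitz function `f`,
a primitive `G` of `g`, and finitely many locally Lipschitz functions `r i`. -/
theorem integral_deriv_mul_mul_prod_eq_zero {ι : Type*} [DecidableEq ι] {S : Set ℝ}
    [hS' : S.OrdConnected] (hS : IsOpen S) (hne : S.Nonempty) {f G g : ℝ → ℝ} {s : Finset ι}
    {r : ι → ℝ → ℝ} (hf : LocallyLipschitzOn S f) (hr : ∀ i ∈ s, LocallyLipschitzOn S (r i))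
    (hg : ∀ a ∈ S, ∀ b ∈ S, IntervalIntegrable g volume a b)
    (hG : ∀ a ∈ S, ∀ b ∈ S, G b - G a = ∫ t in a..b, g t)
    (htop : Tendsto (fun t : S => f t * G t * ∏ i ∈ s, r i t) atTop (𝓝 0))
    (hbot : Tendsto (fun t : S => f t * G t * ∏ i ∈ s, r i t) atBot (𝓝 0))
    {I : ℝ → ℝ} (hI : ∀ᵐ t ∂volume.restrict S, I t = deriv f t * G t * ∏ i ∈ s, r i t +
      f t * g t * ∏ i ∈ s, r i t +
      ∑ i ∈ s, f t * G t * (deriv (r i) t * ∏ j ∈ s.erase i, r j t))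
    (hint : IntegrableOn I S) :
    ∫ t in S, I t = 0 := by
  refine integral_eq_zero_of_vanishes_at_ends hS hne hint
    (H := fun t => f t * G t * ∏ i ∈ s, r i t) ?_ htop hbot
  intro a ha b hb hab
  have hsub : Set.uIcc a b ⊆ S := hS'.uIcc_subset ha hb
  have hac : ∀ {u : ℝ → ℝ}, LocallyLipschitzOn S u → AbsolutelyContinuousOnInterval u a b := by
    intro u hu
    obtain ⟨K, hK⟩ := (hu.mono hsub).exists_lipschitzOnWith_of_compact isCompact_uIcc
    exact hK.absolutelyContinuousOnInterval
  have hG' : ∀ t ∈ S, G t = G a + ∫ x in a..t, g x := fun t ht => by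
    rw [← hG a ha t ht]; ring
  have hf' := hac hf
  have hr' := fun i hi => hac (hr i hi)
  -- On `[a, b]`, `G` is replaced by the explicit primitive of `g`: absolutely continuous, with
  -- derivative `g` almost everywhere.
  have hGa : AbsolutelyContinuousOnInterval (fun t => G a + ∫ x in a..t, g x) a b :=
    ((LipschitzWith.const (G a)).lipschitzOnWith
      (s := Set.uIcc a b)).absolutelyContinuousOnInterval.fun_add
    ((hg a ha b hb).absolutelyContinuousOnInterval_intervalIntegral Set.left_mem_uIcc)
  have hH := (hf'.fun_mul hGa).fun_mul (AbsolutelyContinuousOnInterval.prod s hr')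
  have hFTC := hH.integral_deriv_eq_sub
  rw [← hG' a ha, ← hG' b hb] at hFTC
  rw [← hFTC]
  refine intervalIntegral.integral_congr_ae ?_
  have hrd : ∀ᵐ t, t ∈ Set.uIcc a b → ∀ i ∈ s, DifferentiableAt ℝ (r i) t := by
    have := (ae_ball_iff s.countable_toSet).mpr fun i hi => (hr' i hi).ae_differentiableAt
    filter_upwards [this] with t ht hmem i hi using ht i hi hmem
  filter_upwards [hf'.ae_differentiableAt, hrd, (hg a ha b hb).ae_hasDerivAt_integral,
    (ae_restrict_iff' hS.measurableSet).mp hI] with t h1 h2 h3 h4 hmem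
  have hm : t ∈ Set.uIcc a b := Set.uIoc_subset_uIcc hmem
  have hd1 := (h1 hm).hasDerivAt
  have hd2 := (h3 hm a Set.left_mem_uIcc).const_add (G a)
  have hd3 := HasDerivAt.fun_finsetProd fun i hi => (h2 hm i hi).hasDerivAt
  have hd := (hd1.fun_mul hd2).fun_mul hd3
  rw [hd.deriv, h4 (hsub hm), ← hG' t (hsub hm), add_mul, Finset.mul_sum]
  simp only [smul_eq_mul, mul_comm (deriv (r _) t)]

/-! ### Summation by parts, and one formula for both types of variable -/

/-- Summation by parts on `{0, 1, 2, …}`. -/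
theorem tsum_sub_mul_add_mul_eq_zero {f G g : ℕ → ℝ} (h0 : G 0 = g 0)
    (hG : ∀ n, G (n + 1) - G n = g (n + 1)) (hlim : Tendsto (fun n => f n * G n) atTop (𝓝 0))
    (h1 : Summable fun n => (f (n + 1) - f n) * G n) (h2 : Summable fun n => f n * g n) :
    ∑' n, ((f (n + 1) - f n) * G n + f n * g n) = 0 := by
  have h := (h1.add h2).hasSum.tendsto_sum_nat
  -- The sum telescopes to `f (N + 1) * G N`. Since `hlim` controls only equal indices, this is
  -- written as a boundary term minus a term of the summable series `h2`; both tend to zero.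
  have hpart : ∀ N, ∑ n ∈ Finset.range (N + 1), ((f (n + 1) - f n) * G n + f n * g n) =
      f (N + 1) * G (N + 1) - f (N + 1) * g (N + 1) := by
    intro N
    induction N with
    | zero => simp [h0, ← hG 0]; ring
    | succ N ih => rw [Finset.sum_range_succ, ih, ← hG (N + 1), ← hG N]; ring
  have h3 : Tendsto (fun N => f N * G N - f N * g N) atTop (𝓝 0) := by
    simpa using hlim.sub h2.tendsto_atTop_zero
  refine tendsto_nhds_unique ((tendsto_add_atTop_iff_nat 1).mpr h) ?_
  simp only [hpart]
  exact (tendsto_add_atTop_iff_nat 1).mpr h3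

namespace VarType

instance sigmaFinite_refMeasure (T : VarType) : SigmaFinite T.refMeasure := by
  cases T with
  | continuous S h1 h2 h3 => exact inferInstanceAs (SigmaFinite (volume.restrict S))
  | discrete =>
    refine ⟨⟨⟨fun n : ℕ => Set.Iio (n : ℝ), fun _ => trivial, fun n => ?_, ?_⟩⟩⟩
    · rw [refMeasure, Measure.sum_apply _ measurableSet_Iio]
      rw [tsum_eq_sum (s := Finset.range n)]
      · exact ENNReal.sum_lt_top.mpr fun i _ => measure_lt_top _ _
      · intro i hi
        simp only [Finset.mem_range, not_lt] at hi
        simp [Measure.dirac_apply' _ measurableSet_Iio, hi]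
    · exact Set.eq_univ_of_forall fun x => Set.mem_iUnion.mpr (exists_nat_gt x)

theorem ae_mem_support (T : VarType) : ∀ᵐ t ∂T.refMeasure, t ∈ T.support := by
  cases T with
  | continuous S h1 h2 h3 => exact ae_restrict_mem h1.measurableSet
  | discrete =>
    refine Measure.ae_sum_iff.mpr fun n => ?_
    rw [ae_dirac_eq]
    exact ⟨n, rfl⟩

theorem hasSum_of_integrable_discrete {h : ℝ → ℝ} (hh : Integrable h discrete.refMeasure) :
    HasSum (fun n : ℕ => h n) (∫ t, h t ∂discrete.refMeasure) := by
  simpa only [integral_dirac] using! hasSum_integral_measure hh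

theorem forall_of_ae_discrete {P : ℝ → Prop} (h : ∀ᵐ t ∂discrete.refMeasure, P t) (n : ℕ) :
    P n := by
  have := ae_mono (Measure.le_sum (fun n : ℕ => Measure.dirac (n : ℝ)) n) h
  exact (ae_dirac_eq (n : ℝ) ▸ this : ∀ᶠ t in pure (n : ℝ), P t)

theorem setIntegral_Iic_discrete {h : ℝ → ℝ} (hh : Integrable h discrete.refMeasure) (n : ℕ) :
    ∫ t in Set.Iic (n : ℝ), h t ∂discrete.refMeasure = ∑ i ∈ Finset.range (n + 1), h i := by
  rw [← integral_indicator measurableSet_Iic,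
    ← (hasSum_of_integrable_discrete (hh.indicator measurableSet_Iic)).tsum_eq,
    tsum_eq_sum (s := Finset.range (n + 1))]
  · refine Finset.sum_congr rfl fun i hi => ?_
    have : i ≤ n := by simpa [Nat.lt_succ_iff] using hi
    simp [this]
  · intro i hi
    have : ¬ i ≤ n := by simpa [Nat.lt_succ_iff] using hi
    simp [this]

/-- The derivative of a function of a continuous variable, or the forward difference of a function
of a discrete variable. -/
noncomputable def diff (T : VarType) (f : ℝ → ℝ) (t : ℝ) : ℝ :=
  match T with
  | continuous _ _ _ _ => deriv f t
  | discrete => f (t + 1) - f t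

/-- Integration by parts for a scalar variable of either type. -/
theorem integral_parts_eq_zero {ι : Type*} [DecidableEq ι] (T : VarType) {q : ℝ → ℝ → ℝ} {s₀ : ℝ}
    (hint : ∀ᶠ a in 𝓝 s₀, Integrable (q a) T.refMeasure)
    (hlip : ∀ y ∈ T.support, ∃ C : ℝ≥0, ∃ U ∈ 𝓝 s₀, ∃ W ∈ 𝓝 y, ∀ y' ∈ W ∩ T.support,
      LipschitzOnWith C (fun a => q a y') U)
    (hdiff : ∀ᵐ t ∂T.refMeasure, DifferentiableAt ℝ (fun a => q a t) s₀)
    (hcdf : ∀ᵐ t ∂T.refMeasure,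
      DifferentiableAt ℝ (fun a => ∫ x in Set.Iic t, q a x ∂T.refMeasure) s₀)
    {G g : ℝ → ℝ} (hG : ∀ t, G t = deriv (fun a => ∫ x in Set.Iic t, q a x ∂T.refMeasure) s₀)
    (hg : ∀ t, g t = deriv (fun a => q a t) s₀)
    {f : ℝ → ℝ} {s : Finset ι} {r : ι → ℝ → ℝ}
    (hf : T ≠ discrete → LocallyLipschitzOn T.support f)
    (hr : ∀ i ∈ s, LocallyLipschitzOn T.support (r i)) (hs : T = discrete → s = ∅)
    (hends : T.VanishesAtEnds fun t => f t * G t * ∏ i ∈ s, r i t)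
    (h1 : Integrable (fun t => T.diff f t * G t * ∏ i ∈ s, r i t) T.refMeasure)
    (h2 : Integrable (fun t => f t * g t * ∏ i ∈ s, r i t) T.refMeasure)
    (h3 : ∀ i ∈ s, Integrable
      (fun t => f t * G t * (deriv (r i) t * ∏ j ∈ s.erase i, r j t)) T.refMeasure) :
    ∫ t, (T.diff f t * G t * ∏ i ∈ s, r i t + f t * g t * ∏ i ∈ s, r i t +
      ∑ i ∈ s, f t * G t * (deriv (r i) t * ∏ j ∈ s.erase i, r j t)) ∂T.refMeasure = 0 := by
  have hI := (h1.add h2).add (integrable_finsetSum s h3)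
  cases T with
  | continuous S hS hS' hne =>
    refine integral_deriv_mul_mul_prod_eq_zero hS hne (f := f) (G := G) (g := g) (s := s) (r := r)
      (hf (by simp)) hr ?_ ?_ hends.1 hends.2 (ae_of_all _ fun t => rfl) hI
    · intro a ha b hb
      simpa only [funext hg] using
        (hasDerivAt_intervalIntegral_of_locally_lipschitz hint hlip hdiff ha hb).1
    · intro a ha b hb
      simpa only [hG, hg] using! deriv_cdf_sub_deriv_cdf hS hint hlip hdiff hcdf ha hb
  | discrete =>
    -- With no child densities in the product, the forward difference needs no Leibniz rule for
    -- several factors.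
    obtain rfl := hs rfl
    simp only [Finset.prod_empty, mul_one, Finset.sum_empty, add_zero] at *
    have hGn : ∀ n : ℕ, G n = ∑ i ∈ Finset.range (n + 1), g i := by
      intro n
      have hev : (fun a => ∫ x in Set.Iic (n : ℝ), q a x ∂discrete.refMeasure) =ᶠ[𝓝 s₀]
          fun a => ∑ i ∈ Finset.range (n + 1), q a i := by
        filter_upwards [hint] with a ha using setIntegral_Iic_discrete ha n
      rw [hG, hev.deriv_eq, deriv_fun_sum fun i _ => forall_of_ae_discrete hdiff i]
      simp only [hg]
    have hs1 := (hasSum_of_integrable_discrete h1).summable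
    have hs2 := (hasSum_of_integrable_discrete h2).summable
    refine (hasSum_of_integrable_discrete (h1.add h2)).tsum_eq.symm.trans ?_
    have := tsum_sub_mul_add_mul_eq_zero (f := fun n : ℕ => f n) (G := fun n : ℕ => G n)
      (g := fun n : ℕ => g n) (by simpa using hGn 0)
      (fun n => by simp only [hGn, Finset.sum_range_succ _ (n + 1)]; ring) hends
      (by simpa [diff] using hs1) hs2
    simpa [diff] using this

end VarType

/-! ### Fubini in one coordinate -/

section Pi

variable {V : Type*} [Fintype V] [DecidableEq V] (μ : V → Measure ℝ) [∀ v, SigmaFinite (μ v)]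

/-- Splitting off one coordinate preserves the product measure. -/
theorem exists_measurePreserving_split (v : V) :
    ∃ e : (V → ℝ) ≃ᵐ ({i : V // ¬ i = v} → ℝ) × ℝ,
      MeasurePreserving e (Measure.pi μ)
        ((Measure.pi fun i : {i : V // ¬ i = v} => μ i).prod (μ v)) ∧
      ∀ z t, e (Function.update z v t) = ((e z).1, t) := by
  have h1 := measurePreserving_piEquivPiSubtypeProd μ (fun i => i = v)
  -- Identifies two `Fintype` instances on the one-point index type, so that
  -- `measurePreserving_piUnique` composes with `h1`.
  rw [Subsingleton.elim (Subtype.fintype fun i => i = v) (Fintype.subtypeEq v)] at h1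
  refine ⟨((MeasurableEquiv.piEquivPiSubtypeProd (fun _ => ℝ) fun i => i = v).trans
    ((MeasurableEquiv.piUnique fun _ : {i : V // i = v} => ℝ).prodCongr
      (MeasurableEquiv.refl _))).trans MeasurableEquiv.prodComm, ?_, ?_⟩
  · exact (Measure.measurePreserving_swap).comp
      (((measurePreserving_piUnique _).prod (MeasurePreserving.id _)).comp h1)
  · intro z t
    refine Prod.ext ?_ ?_
    · funext i
      exact Function.update_of_ne i.2 _ _
    · exact Function.update_self v t z

/-- Fubini after splitting off the coordinate `v`. Quantifying over full configurations, whose value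
at `v` is overwritten, keeps the smaller product out of later statements. -/
theorem ae_ae_update (v : V) {P : (V → ℝ) → Prop} (h : ∀ᵐ z ∂Measure.pi μ, P z) :
    ∀ᵐ z ∂Measure.pi μ, ∀ᵐ t ∂μ v, P (Function.update z v t) := by
  obtain ⟨e, he, heu⟩ := exists_measurePreserving_split μ v
  have h' := (he.symm e).quasiMeasurePreserving.ae h
  have h'' := he.quasiMeasurePreserving.ae
    (Measure.quasiMeasurePreserving_fst.ae (Measure.ae_ae_of_ae_prod h'))
  filter_upwards [h''] with z hz
  filter_upwards [hz] with t ht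
  rwa [← heu, e.symm_apply_apply] at ht

theorem ae_integrable_update (v : V) {h : (V → ℝ) → ℝ} (hh : Integrable h (Measure.pi μ)) :
    ∀ᵐ z ∂Measure.pi μ, Integrable (fun t => h (Function.update z v t)) (μ v) := by
  obtain ⟨e, he, heu⟩ := exists_measurePreserving_split μ v
  have h' := ((he.symm e).integrable_comp_emb e.symm.measurableEmbedding).mpr hh
  have h'' := he.quasiMeasurePreserving.ae
    (Measure.quasiMeasurePreserving_fst.ae h'.prod_right_ae)
  filter_upwards [h''] with z hz
  refine hz.congr (ae_of_all _ fun t => ?_)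
  simp [← heu]

theorem integral_eq_zero_of_ae_integral_update (v : V) {h : (V → ℝ) → ℝ}
    (hh : Integrable h (Measure.pi μ))
    (h0 : ∀ᵐ z ∂Measure.pi μ, ∫ t, h (Function.update z v t) ∂μ v = 0) :
    ∫ z, h z ∂Measure.pi μ = 0 := by
  obtain ⟨e, he, heu⟩ := exists_measurePreserving_split μ v
  have hI := ((he.symm e).integrable_comp_emb e.symm.measurableEmbedding).mpr hh
  rw [← (he.symm e).integral_comp e.symm.measurableEmbedding h]
  refine (integral_prod _ hI).trans ?_
  -- The slice integral does not depend on the overwritten coordinate, so a single good value `t₀`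
  -- suffices; it exists as soon as `μ v ≠ 0`.
  rcases eq_or_ne (μ v) 0 with hv | hv
  · simp [hv]
  have hz := (he.symm e).quasiMeasurePreserving.ae h0
  have : (ae (μ v)).NeBot := ae_neBot.mpr hv
  refine (integral_congr_ae ?_).trans (integral_zero _ _)
  filter_upwards [Measure.ae_ae_of_ae_prod hz] with y hy
  obtain ⟨t₀, ht₀⟩ := hy.exists
  refine (integral_congr_ae (ae_of_all _ fun t => ?_)).trans ht₀
  change h (e.symm (y, t)) = _
  congr 1
  rw [e.symm_apply_eq, heu, e.apply_symm_apply]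

end Pi

/-! ### Which factors depend on which variable -/

theorem Sum.elim_update_right' {α β γ : Type*} [DecidableEq α] [DecidableEq β] (f : α → γ)
    (g : β → γ) (b : β) (c : γ) :
    Sum.elim f (Function.update g b c) = Function.update (Sum.elim f g) (Sum.inr b) c :=
  Sum.update_elim_inr.symm

theorem Sum.elim_update_left' {α β γ : Type*} [DecidableEq α] [DecidableEq β] (f : α → γ)
    (g : β → γ) (a : α) (c : γ) :
    Sum.elim (Function.update f a c) g = Function.update (Sum.elim f g) (Sum.inl a) c :=
  Sum.update_elim_inl.symm

namespace GraphicalModel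

variable {V K : Type*} [DecidableEq V] [Fintype V] [DecidableEq K] (M : GraphicalModel V K)

theorem mem_ch {s : K ⊕ V} {w : V} : w ∈ M.ch s ↔ s ∈ M.pa w := by simp [ch]

theorem parent_ne {s : K ⊕ V} {v : V} (h : s ∈ M.pa v) : s ≠ Sum.inr v := by
  rintro rfl
  exact M.acyclic v (Relation.TransGen.single h)

theorem not_mem_ch_self (v : V) : v ∉ M.ch (Sum.inr v) := fun h =>
  M.parent_ne (M.mem_ch.mp h) rfl

theorem D_eq_diff (v : V) (f : (V → ℝ) → ℝ) (z : V → ℝ) :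
    M.D v f z = (M.type v).diff (fun t => f (Function.update z v t)) (z v) := by
  unfold D
  split <;> rename_i h <;> rw [h] <;> simp [VarType.diff]

theorem D_update (v : V) (f : (V → ℝ) → ℝ) (z : V → ℝ) (t : ℝ) :
    M.D v f (Function.update z v t) =
      (M.type v).diff (fun t => f (Function.update z v t)) t := by
  simp [D_eq_diff]

theorem ae_mem_support : ∀ᵐ z ∂M.base, ∀ u, z u ∈ (M.type u).support := by
  refine ae_all_iff.mpr fun u => ?_
  exact (Measure.quasiMeasurePreserving_eval _ u).ae (M.type u).ae_mem_support

/-- A conditional density does not depend on variables other than its own and its parents. -/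
theorem q_update_of_ne {s : K ⊕ V} {w : V} (h : s ≠ Sum.inr w) (h' : s ∉ M.pa w) (x : K ⊕ V → ℝ)
    (a : ℝ) : M.q w (Function.update x s a) = M.q w x :=
  M.q_local w _ _ (Function.update_of_ne h.symm _ _) fun r hr =>
    Function.update_of_ne (fun e : r = s => h' (e ▸ hr)) _ _

theorem Q_update_of_ne {s : K ⊕ V} {w : V} (h : s ≠ Sum.inr w) (h' : s ∉ M.pa w) (x : K ⊕ V → ℝ)
    (a : ℝ) : M.Q w (Function.update x s a) = M.Q w x := by
  unfold Q
  rw [Function.update_of_ne h.symm]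
  congr 1
  funext t
  rw [Function.update_comm h, M.q_update_of_ne h h']

/-- The nabla of an edge `r → w` sees only `w` and its parents. As `r` is a parent and `s` is not,
changing `s` commutes with differentiating in `r`. -/
theorem nabla_update_of_ne {s r : K ⊕ V} {w : V} (h : s ≠ Sum.inr w) (h' : s ∉ M.pa w)
    (hr : r ∈ M.pa w) (x : K ⊕ V → ℝ) (a : ℝ) :
    M.nabla r w (Function.update x s a) = M.nabla r w x := by
  have hrs : r ≠ s := fun e => h' (e ▸ hr)
  unfold nabla partialD
  rw [M.q_update_of_ne h h', Function.update_of_ne hrs]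
  congr 3
  funext b
  rw [Function.update_comm hrs.symm, M.Q_update_of_ne h h']

theorem IsPath.transGen {M : GraphicalModel V K} {k : K} :
    ∀ {p : List V} {v : V}, M.IsPath k (v :: p) →
      ∀ w ∈ p, Relation.TransGen (fun u w => Sum.inr u ∈ M.pa w) w v
  | [], _, _, w, hw => by simp at hw
  | u :: p, v, h, w, hw => by
    have huv : Sum.inr u ∈ M.pa v := h.1
    rcases List.mem_cons.mp hw with rfl | hw
    · exact Relation.TransGen.single huv
    · exact (IsPath.transGen h.2 w hw).tail huv

theorem pathNabla_update {k : K} {v : V} (x : K ⊕ V → ℝ) (t : ℝ) :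
    ∀ {p : List V}, M.IsPath k p → (∀ w ∈ p, v ≠ w ∧ Sum.inr v ∉ M.pa w) →
      M.pathNabla k (Function.update x (Sum.inr v) t) p = M.pathNabla k x p
  | [], _, _ => rfl
  | w :: p, h, hp => by
    rw [pathNabla, pathNabla, pathNabla_update x t h.2 fun u hu => hp u (by simp [hu]),
      M.nabla_update_of_ne (by simpa using (hp w (by simp)).1) (hp w (by simp)).2 h.1]

/-- The variable-nablas along a path do not depend on a variable to which the path extends. -/
theorem IsPath.pathNabla_update {k : K} {v : V} {p : List V} (h : M.IsPath k (v :: p))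
    (x : K ⊕ V → ℝ) (t : ℝ) :
    M.pathNabla k (Function.update x (Sum.inr v) t) p = M.pathNabla k x p := by
  refine M.pathNabla_update x t h.2 fun w hw => ?_
  have hwv := h.transGen w hw
  -- An edge `v → w` back to an earlier vertex would close a directed cycle.
  refine ⟨?_, fun hvw => M.acyclic w (hwv.tail hvw)⟩
  rintro rfl
  exact M.acyclic v hwv

theorem measurable_density {φ : K → ℝ} (hφ : φ ∈ M.Θ) : Measurable (M.density φ) :=
  Finset.measurable_fun_prod _ fun v _ => M.q_measurable v φ hφ

theorem density_nonneg {φ : K → ℝ} (hφ : φ ∈ M.Θ) : ∀ᵐ z ∂M.base, 0 ≤ M.density φ z := by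
  filter_upwards [M.ae_mem_support] with z hz
  exact Finset.prod_nonneg fun v _ => M.q_nonneg v φ hφ z hz

theorem integrable_law_iff {φ : K → ℝ} (hφ : φ ∈ M.Θ) {h : (V → ℝ) → ℝ} :
    Integrable h (M.law φ) ↔ Integrable (fun z => h z * M.density φ z) M.base := by
  rw [law, integrable_withDensity_iff_integrable_smul'
    (M.measurable_density hφ).ennreal_ofReal (ae_of_all _ fun _ => ENNReal.ofReal_lt_top)]
  refine integrable_congr ?_
  filter_upwards [M.density_nonneg hφ] with z hz
  rw [ENNReal.toReal_ofReal hz, smul_eq_mul, mul_comm]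

theorem integral_law {φ : K → ℝ} (hφ : φ ∈ M.Θ) (h : (V → ℝ) → ℝ) :
    ∫ z, h z ∂M.law φ = ∫ z, h z * M.density φ z ∂M.base := by
  rw [law, integral_withDensity_eq_integral_toReal_smul
    (M.measurable_density hφ).ennreal_ofReal (ae_of_all _ fun _ => ENNReal.ofReal_lt_top)]
  refine integral_congr_ae ?_
  filter_upwards [M.density_nonneg hφ] with z hz
  rw [ENNReal.toReal_ofReal hz, smul_eq_mul, mul_comm]

theorem integrable_q {φ : K → ℝ} (hφ : φ ∈ M.Θ) (v : V) {z : V → ℝ}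
    (hz : ∀ u, z u ∈ (M.type u).support) :
    Integrable (fun t => M.q v (Sum.elim φ (Function.update z v t))) (M.type v).refMeasure := by
  refine ⟨((M.q_measurable v φ hφ).comp (measurable_update z)).aestronglyMeasurable, ?_⟩
  rw [hasFiniteIntegral_iff_ofReal, M.q_normalized v φ hφ z hz]
  · exact ENNReal.one_lt_top
  · filter_upwards [(M.type v).ae_mem_support] with t ht
    refine M.q_nonneg v φ hφ _ fun u => ?_
    rcases eq_or_ne u v with rfl | h
    · simpa using ht
    · simpa [h] using hz u

/-- The conditional densities stay integrable when a continuous parent or the parameter `φ_k`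
varies slightly. -/
theorem eventually_integrable_q {φ : K → ℝ} {k : K} (hφ : φ ∈ M.Θ)
    (hφk : ∀ᶠ t in 𝓝 (φ k), Function.update φ k t ∈ M.Θ) {p : List V} {v : V}
    (hp : tip k p ∈ M.pa v) {z : V → ℝ} (hz : ∀ u, z u ∈ (M.type u).support) :
    ∀ᶠ a in 𝓝 (Sum.elim φ z (tip k p)), Integrable
      (fun t => M.q v (Function.update (Sum.elim φ (Function.update z v t)) (tip k p) a))
      (M.type v).refMeasure := by
  cases p with
  | nil =>
    filter_upwards [hφk] with a ha
    simpa only [tip, ← Sum.elim_update_left'] using M.integrable_q ha v hz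
  | cons u p =>
    have huv : u ≠ v := fun h => M.parent_ne hp (congrArg Sum.inr h)
    -- A parent variable is internal, hence continuous with open support, so nearby values stay
    -- where normalization is available.
    have hu : (M.type u).support ∈ 𝓝 (z u) := by
      have h1 := M.internal_continuous u v hp
      have h2 := hz u
      revert h1 h2
      cases M.type u with
      | continuous S hS _ _ => exact fun _ h => hS.mem_nhds h
      | discrete => exact fun h => absurd rfl h
    filter_upwards [hu] with a ha
    have := M.integrable_q hφ v (z := Function.update z u a) fun w => by
      rcases eq_or_ne w u with rfl | h
      · simpa using ha
      · simpa [h] using hz w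
    simpa only [tip, ← Sum.elim_update_right', Function.update_comm huv] using this

/-- The conditional distribution function, as a function of a parent and of the variable itself. -/
theorem Q_update_update {s : K ⊕ V} {v : V} (hs : s ≠ Sum.inr v) (φ : K → ℝ) (z : V → ℝ)
    (t a : ℝ) :
    M.Q v (Function.update (Sum.elim φ (Function.update z v t)) s a) =
      ∫ x in Set.Iic t, M.q v (Function.update (Sum.elim φ (Function.update z v x)) s a)
        ∂(M.type v).refMeasure := by
  have hcomm : ∀ b : ℝ, Function.update (Sum.elim φ (Function.update z v b)) s a =
      Function.update (Function.update (Sum.elim φ z) s a) (Sum.inr v) b := fun b => by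
    rw [Sum.elim_update_right', Function.update_comm hs]
  simp only [Q, hcomm, Function.update_self, Function.update_idem]

theorem elim_update_apply {s : K ⊕ V} {v : V} (hs : s ≠ Sum.inr v) (φ : K → ℝ) (z : V → ℝ)
    (t : ℝ) : Sum.elim φ (Function.update z v t) s = Sum.elim φ z s := by
  rw [Sum.elim_update_right', Function.update_of_ne hs]

/-- Where `q = 0` the left side is zero through division by zero, and accessibility makes the right
side zero too. -/
theorem nabla_mul_q {s : K ⊕ V} {v : V} {x : K ⊕ V → ℝ}
    (h : M.q v x = 0 → partialD s (M.Q v) x = 0) :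
    M.nabla s v x * M.q v x = -partialD s (M.Q v) x := by
  unfold nabla
  rcases eq_or_ne (M.q v x) 0 with h0 | h0
  · rw [h0, h h0]; simp
  · field_simp

/-- The factors of the joint density that involve `z_v`: that of `z_v` itself and those of its
children. -/
theorem prod_q_split (v : V) (F : V → ℝ) :
    ∏ w ∈ Finset.univ.erase v, F w =
      (∏ w ∈ M.ch (Sum.inr v), F w) *
        ∏ w ∈ (Finset.univ.erase v) \ M.ch (Sum.inr v), F w := by
  rw [mul_comm, Finset.prod_sdiff]
  intro w hw
  simp only [Finset.mem_erase, Finset.mem_univ, and_true]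
  rintro rfl
  exact M.not_mem_ch_self w hw

/-- When the derivative sits on a child `w`, the factor of `v` is still present; isolating it lets
it cancel the denominator of the nabla. The last product is the same as in `prod_q_split`. -/
theorem prod_q_split_erase (v : V) (F : V → ℝ) {w : V} (hw : w ∈ M.ch (Sum.inr v)) :
    ∏ u ∈ Finset.univ.erase w, F u =
      F v * ((∏ u ∈ (M.ch (Sum.inr v)).erase w, F u) *
        ∏ u ∈ (Finset.univ.erase v) \ M.ch (Sum.inr v), F u) := by
  have hv := M.not_mem_ch_self v
  have hvw : v ≠ w := fun h => hv (h ▸ hw)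
  rw [← Finset.mul_prod_erase (Finset.univ.erase w) F (a := v) (by simp [hvw]), mul_comm (∏ u ∈ _, _),
    ← Finset.prod_sdiff (s₁ := (M.ch (Sum.inr v)).erase w)
      (s₂ := (Finset.univ.erase w).erase v)]
  · congr 3
    ext u
    simp only [Finset.mem_sdiff, Finset.mem_erase, Finset.mem_univ, and_true]
    constructor
    · rintro ⟨⟨h1, h2⟩, h3⟩
      exact ⟨h1, fun h => h3 ⟨h2, h⟩⟩
    · rintro ⟨h1, h2⟩
      have : u ≠ w := fun h => h2 (h ▸ hw)
      exact ⟨⟨h1, this⟩, fun h => h2 h.2⟩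
  · intro u hu
    simp only [Finset.mem_erase, Finset.mem_univ, and_true] at hu ⊢
    exact ⟨fun h => hv (h ▸ hu.2), hu.1⟩

end GraphicalModel

/-! ### Integration by parts along paths and induction from the leaves -/

theorem LocallyLipschitzOn.const_mul_real {S : Set ℝ} {f : ℝ → ℝ} (hf : LocallyLipschitzOn S f)
    (c : ℝ) : LocallyLipschitzOn S fun t => c * f t := by
  intro x hx
  obtain ⟨L, U, hU, hL⟩ := hf hx
  exact ⟨‖c‖₊ * L, U, hU, (lipschitzWith_smul c).comp_lipschitzOnWith hL⟩

namespace VarType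

theorem VanishesAtEnds.const_mul {T : VarType} {F : ℝ → ℝ} (h : T.VanishesAtEnds F) (c : ℝ) :
    T.VanishesAtEnds fun t => c * F t := by
  cases T with
  | continuous S _ _ _ => exact ⟨by simpa using h.1.const_mul c, by simpa using h.2.const_mul c⟩
  | discrete => simpa [VanishesAtEnds] using Tendsto.const_mul c h

theorem diff_const_mul (T : VarType) (c : ℝ) (F : ℝ → ℝ) (t : ℝ) :
    T.diff (fun t => c * F t) t = c * T.diff F t := by
  cases T with
  | continuous S _ _ _ => simp [diff]
  | discrete => simp [diff, mul_sub]

end VarType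

namespace GraphicalModel

variable {V K : Type*} [DecidableEq V] [Fintype V] [DecidableEq K] (M : GraphicalModel V K)

/-- The integrand that arises when the derivative along the path `p` falls on the conditional
density of `z_v`. -/
noncomputable def score (f : (V → ℝ) → ℝ) (φ : K → ℝ) (k : K) (p : List V) (v : V)
    (z : V → ℝ) : ℝ :=
  f z * M.pathNabla k (Sum.elim φ z) p * (partialD (tip k p) (M.q v) (Sum.elim φ z) *
    ∏ w ∈ Finset.univ.erase v, M.q w (Sum.elim φ z))

/-- Integration by parts in the variable `z_v`, with the other variables fixed. -/
theorem integral_update_score_eq_zero {f : (V → ℝ) → ℝ} {φ : K → ℝ} {k : K}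
    (hφ : φ ∈ M.Θ) (hφk : ∀ᶠ t in 𝓝 (φ k), Function.update φ k t ∈ M.Θ)
    (hnabla : M.HasNablas φ k) (hf : M.Admissible f φ k) {p : List V} {v : V}
    (hp : M.IsPath k (v :: p)) {z : V → ℝ} (hz : ∀ u, z u ∈ (M.type u).support)
    (hcdf : ∀ᵐ t ∂(M.type v).refMeasure, DifferentiableAt ℝ
      (fun a => M.Q v (Function.update (Sum.elim φ (Function.update z v t)) (tip k p) a))
      (Sum.elim φ (Function.update z v t) (tip k p)))
    (hdens : ∀ᵐ t ∂(M.type v).refMeasure, DifferentiableAt ℝ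
      (fun a => M.q v (Function.update (Sum.elim φ (Function.update z v t)) (tip k p) a))
      (Sum.elim φ (Function.update z v t) (tip k p)))
    (hquot : ∀ᵐ t ∂(M.type v).refMeasure, M.q v (Sum.elim φ (Function.update z v t)) = 0 →
      partialD (tip k p) (M.Q v) (Sum.elim φ (Function.update z v t)) = 0)
    (hends : (M.type v).VanishesAtEnds fun t => f (Function.update z v t) *
        partialD (tip k p) (M.Q v) (Sum.elim φ (Function.update z v t)) *
        ∏ w ∈ M.ch (Sum.inr v), M.q w (Sum.elim φ (Function.update z v t)))
    (hA : Integrable (fun t => M.score f φ k p v (Function.update z v t)) (M.type v).refMeasure)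
    (hB : Integrable (fun t => M.pathNabla k (Sum.elim φ (Function.update z v t)) (v :: p) *
      M.D v f (Function.update z v t) * M.density φ (Function.update z v t)) (M.type v).refMeasure)
    (hC : ∀ w ∈ M.ch (Sum.inr v), Integrable
      (fun t => M.score f φ k (v :: p) w (Function.update z v t)) (M.type v).refMeasure) :
    ∫ t, (M.score f φ k p v (Function.update z v t) -
      M.pathNabla k (Sum.elim φ (Function.update z v t)) (v :: p) *
        M.D v f (Function.update z v t) * M.density φ (Function.update z v t) -
      ∑ w ∈ M.ch (Sum.inr v), M.score f φ k (v :: p) w (Function.update z v t))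
        ∂(M.type v).refMeasure = 0 := by
  have hs : tip k p ≠ Sum.inr v := M.parent_ne hp.1
  have hmem : ∀ y ∈ (M.type v).support, ∀ u, Function.update z v y u ∈ (M.type u).support := by
    intro y hy u
    rcases eq_or_ne u v with rfl | h
    · simpa using hy
    · simpa [h] using hz u
  set s₀ := Sum.elim φ z (tip k p) with hs₀
  set q' : ℝ → ℝ → ℝ := fun a t =>
    M.q v (Function.update (Sum.elim φ (Function.update z v t)) (tip k p) a) with hq'
  set G : ℝ → ℝ := fun t =>
    deriv (fun a => ∫ x in Set.Iic t, q' a x ∂(M.type v).refMeasure) s₀ with hG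
  set g : ℝ → ℝ := fun t => deriv (fun a => q' a t) s₀ with hg
  set r : V → ℝ → ℝ := fun w t => M.q w (Sum.elim φ (Function.update z v t)) with hr
  set P := M.pathNabla k (Sum.elim φ z) p with hPdef
  set c := ∏ w ∈ (Finset.univ.erase v) \ M.ch (Sum.inr v), M.q w (Sum.elim φ z) with hc
  -- `P` and `c` collect everything independent of `z_v`, so they can be absorbed into the
  -- objective.
  set F : ℝ → ℝ := fun t => (P * c) * f (Function.update z v t) with hF
  have eG : ∀ t, partialD (tip k p) (M.Q v) (Sum.elim φ (Function.update z v t)) = G t := by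
    intro t
    simp only [partialD, M.Q_update_update hs, elim_update_apply hs, hG, hq', hs₀]
  have eg : ∀ t, partialD (tip k p) (M.q v) (Sum.elim φ (Function.update z v t)) = g t := by
    intro t
    simp only [partialD, elim_update_apply hs, hg, hq', hs₀]
  have er : ∀ w t, partialD (Sum.inr v) (M.q w) (Sum.elim φ (Function.update z v t)) =
      deriv (r w) t := by
    intro w t
    simp only [partialD, hr, ← Sum.elim_update_right', Function.update_idem, Sum.elim_inr,
      Function.update_self]
  have eP : ∀ t, M.pathNabla k (Sum.elim φ (Function.update z v t)) p = P := by
    intro t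
    rw [Sum.elim_update_right', hp.pathNabla_update]
  have ec : ∀ t, ∏ w ∈ (Finset.univ.erase v) \ M.ch (Sum.inr v),
      M.q w (Sum.elim φ (Function.update z v t)) = c := by
    intro t
    refine Finset.prod_congr rfl fun w hw => ?_
    simp only [Finset.mem_sdiff, Finset.mem_erase, Finset.mem_univ, and_true, M.mem_ch] at hw
    rw [Sum.elim_update_right', M.q_update_of_ne (by simpa using Ne.symm hw.1) hw.2]
  have eD : ∀ t, (M.type v).diff F t = (P * c) * M.D v f (Function.update z v t) := by
    intro t
    rw [M.D_update, hF, VarType.diff_const_mul]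
  have enabla : ∀ᵐ t ∂(M.type v).refMeasure,
      M.nabla (tip k p) v (Sum.elim φ (Function.update z v t)) * r v t = -G t := by
    filter_upwards [hquot] with t ht
    rw [← eG, ← nabla_mul_q M ht]
  have eA : ∀ t, M.score f φ k p v (Function.update z v t) =
      F t * g t * ∏ w ∈ M.ch (Sum.inr v), r w t := by
    intro t
    rw [score, eP, eg, M.prod_q_split, ec]
    simp only [hF, hr]
    ring
  have eB : ∀ᵐ t ∂(M.type v).refMeasure,
      M.pathNabla k (Sum.elim φ (Function.update z v t)) (v :: p) *
        M.D v f (Function.update z v t) * M.density φ (Function.update z v t) =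
      -((M.type v).diff F t * G t * ∏ w ∈ M.ch (Sum.inr v), r w t) := by
    filter_upwards [enabla] with t ht
    rw [density, ← Finset.mul_prod_erase Finset.univ _ (Finset.mem_univ v), M.prod_q_split, ec,
      pathNabla, eP, eD]
    linear_combination (P * c * M.D v f (Function.update z v t) *
      ∏ w ∈ M.ch (Sum.inr v), r w t) * ht
  have eC : ∀ᵐ t ∂(M.type v).refMeasure, ∀ w ∈ M.ch (Sum.inr v),
      M.score f φ k (v :: p) w (Function.update z v t) =
      -(F t * G t * (deriv (r w) t * ∏ u ∈ (M.ch (Sum.inr v)).erase w, r u t)) := by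
    filter_upwards [enabla] with t ht w hw
    rw [score, pathNabla, eP, M.prod_q_split_erase v _ hw, ec, tip, er]
    linear_combination (F t * deriv (r w) t *
      ∏ u ∈ (M.ch (Sum.inr v)).erase w, r u t) * ht
  have key := (M.type v).integral_parts_eq_zero (q := q') (s₀ := s₀) (G := G) (g := g) (f := F)
    (s := M.ch (Sum.inr v)) (r := r) (M.eventually_integrable_q hφ hφk hp.1 hz) ?_ ?_ ?_
    (fun _ => rfl) (fun _ => rfl) ?_ ?_ ?_ ?_ ?_ ?_ ?_
  · rw [← key]
    refine integral_congr_ae ?_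
    filter_upwards [eB, eC] with t h1 h2
    rw [eA, h1, Finset.sum_congr rfl h2, Finset.sum_neg_distrib]
    ring
  · intro y hy
    obtain ⟨C, U, hU, W, hW, h⟩ := hnabla.lipschitz p v hp _ (hmem y hy)
    rw [elim_update_apply hs] at hU
    rw [Function.update_self] at hW
    exact ⟨C, U, hU, W, hW, by simpa only [Function.update_idem] using h⟩
  · simpa only [elim_update_apply hs] using hdens
  · simpa only [elim_update_apply hs, M.Q_update_update hs] using hcdf
  · exact fun h => (hf.locallyLipschitz v h z hz).const_mul_real _
  -- The Lipschitz condition for the edge `v → w` of the extended path, read at the fixed value of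
  -- `z_w`, says that `q_w` is locally Lipschitz in `z_v`.
  · intro w hw t ht
    obtain ⟨C, U, hU, W, hW, h⟩ :=
      hnabla.lipschitz (v :: p) w ⟨M.mem_ch.mp hw, hp⟩ _ (hmem t ht)
    refine ⟨C, U, ?_, ?_⟩
    · simpa [tip] using mem_nhdsWithin_of_mem_nhds hU
    · simpa only [Function.update_eq_self, tip, ← Sum.elim_update_right', Function.update_idem]
        using h _ ⟨mem_of_mem_nhds hW, hmem t ht w⟩
  · intro h
    refine Finset.eq_empty_of_forall_notMem fun w hw => ?_
    exact M.internal_continuous v w (M.mem_ch.mp hw) h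
  · have := hends.const_mul (P * c)
    simp only [eG, ← mul_assoc] at this
    exact this
  · refine hB.neg.congr ?_
    filter_upwards [eB] with t ht
    rw [Pi.neg_apply, ht, neg_neg]
  · exact hA.congr (ae_of_all _ eA)
  · intro w hw
    refine (hC w hw).neg.congr ?_
    filter_upwards [eC] with t ht
    rw [Pi.neg_apply, ht w hw, neg_neg]

/-- Integration by parts in the variable `z_v` moves the derivative along a path from the
conditional density of `z_v` to `f` and to the conditional densities of the children of `z_v`. -/
theorem integral_score {f : (V → ℝ) → ℝ} {φ : K → ℝ} {k : K}
    (hφ : φ ∈ M.Θ) (hφk : ∀ᶠ t in 𝓝 (φ k), Function.update φ k t ∈ M.Θ)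
    (hnabla : M.HasNablas φ k) (hf : M.Admissible f φ k) {p : List V} {v : V}
    (hp : M.IsPath k (v :: p)) :
    ∫ z, M.score f φ k p v z ∂M.base =
      ∫ z, M.pathNabla k (Sum.elim φ z) (v :: p) * M.D v f z ∂M.law φ +
        ∑ w ∈ M.ch (Sum.inr v), ∫ z, M.score f φ k (v :: p) w z ∂M.base := by
  have hA : Integrable (M.score f φ k p v) M.base := hf.integrable_score p v hp
  have hB := (M.integrable_law_iff hφ).mp (hf.integrable_nabla p v hp)
  have hC : ∀ w ∈ M.ch (Sum.inr v), Integrable (M.score f φ k (v :: p) w) M.base :=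
    fun w hw => hf.integrable_score (v :: p) w ⟨M.mem_ch.mp hw, hp⟩
  have hC' : Integrable (fun z => ∑ w ∈ M.ch (Sum.inr v), M.score f φ k (v :: p) w z) M.base :=
    integrable_finsetSum _ hC
  -- Only the combined integrand vanishes on slices. Integrability of each piece allows Fubini first
  -- and splitting the integral afterwards.
  have hzero := integral_eq_zero_of_ae_integral_update (fun u => (M.type u).refMeasure) v
    ((hA.sub hB).sub hC') (by
      have hCz := (ae_ball_iff (M.ch (Sum.inr v)).countable_toSet).mpr fun w hw =>
        ae_integrable_update (fun u => (M.type u).refMeasure) v (hC w hw)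
      filter_upwards [M.ae_mem_support,
        ae_ae_update (fun u => (M.type u).refMeasure) v (hnabla.differentiable_cdf p v hp),
        ae_ae_update (fun u => (M.type u).refMeasure) v (hnabla.differentiable_density p v hp),
        ae_ae_update (fun u => (M.type u).refMeasure) v (hnabla.quotient p v hp),
        hf.boundary p v hp, ae_integrable_update (fun u => (M.type u).refMeasure) v hA,
        ae_integrable_update (fun u => (M.type u).refMeasure) v hB, hCz]
        with z h1 h2 h3 h4 h5 h6 h7 h8
      exact M.integral_update_score_eq_zero hφ hφk hnabla hf hp h1 h2 h3 h4 h5 h6 h7 h8)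
  have hsplit := (integral_sub' (hA.sub hB) hC').symm.trans hzero
  rw [integral_sub' hA hB, integral_finsetSum _ hC, ← M.integral_law hφ] at hsplit
  linarith

/-- Back-propagation along all the paths that extend a given one. -/
theorem integral_score_eq_integral_BP {f : (V → ℝ) → ℝ} {φ : K → ℝ} {k : K}
    (hφ : φ ∈ M.Θ) (hφk : ∀ᶠ t in 𝓝 (φ k), Function.update φ k t ∈ M.Θ)
    (hnabla : M.HasNablas φ k) (hf : M.Admissible f φ k) (v : V) :
    ∀ p : List V, M.IsPath k (v :: p) →
      Integrable (fun z => M.pathNabla k (Sum.elim φ z) (v :: p) * M.BP f φ z v) (M.law φ) ∧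
      ∫ z, M.score f φ k p v z ∂M.base =
        ∫ z, M.pathNabla k (Sum.elim φ z) (v :: p) * M.BP f φ z v ∂M.law φ := by
  -- The path stays universally quantified, because at a child `w` the hypothesis is needed for the
  -- longer path `v :: p`.
  induction v using M.wellFounded_child.induction with
  | _ v ih =>
  intro p hp
  have hD := hf.integrable_nabla p v hp
  have hch := fun w (hw : w ∈ M.ch (Sum.inr v)) => ih w hw (v :: p) ⟨M.mem_ch.mp hw, hp⟩
  have hsum : (fun z => M.pathNabla k (Sum.elim φ z) (v :: p) * M.BP f φ z v) = fun z =>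
      M.pathNabla k (Sum.elim φ z) (v :: p) * M.D v f z + ∑ w ∈ M.ch (Sum.inr v),
        M.pathNabla k (Sum.elim φ z) (w :: v :: p) * M.BP f φ z w := by
    funext z
    rw [BP_eq, mul_add, Finset.mul_sum]
    congr 1
    refine Finset.sum_congr rfl fun w _ => ?_
    change _ = M.nabla (Sum.inr v) w (Sum.elim φ z) *
      M.pathNabla k (Sum.elim φ z) (v :: p) * M.BP f φ z w
    ring
  have hI := integrable_finsetSum _ fun w hw => (hch w hw).1
  rw [hsum]
  refine ⟨hD.add hI, ?_⟩
  rw [integral_add hD hI, integral_finsetSum _ fun w hw => (hch w hw).1,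
    M.integral_score hφ hφk hnabla hf hp, Finset.sum_congr rfl fun w hw => (hch w hw).2]

/-! ### Differentiation of the expectation in the parameter -/

/-- The derivative of the joint density in a parameter. -/
theorem hasDerivAt_density {φ : K → ℝ} {k : K} {z : V → ℝ}
    (h : ∀ v ∈ M.ch (Sum.inl k), DifferentiableAt ℝ
      (fun a => M.q v (Function.update (Sum.elim φ z) (Sum.inl k) a)) (φ k)) :
    HasDerivAt (fun t => M.density (Function.update φ k t) z)
      (∑ v ∈ M.ch (Sum.inl k), partialD (Sum.inl k) (M.q v) (Sum.elim φ z) *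
        ∏ w ∈ Finset.univ.erase v, M.q w (Sum.elim φ z)) (φ k) := by
  have hq : ∀ v, HasDerivAt (fun t => M.q v (Sum.elim (Function.update φ k t) z))
      (partialD (Sum.inl k) (M.q v) (Sum.elim φ z)) (φ k) ∧
      (v ∉ M.ch (Sum.inl k) → partialD (Sum.inl k) (M.q v) (Sum.elim φ z) = 0) := by
    intro v
    simp only [Sum.elim_update_left', partialD]
    by_cases hv : v ∈ M.ch (Sum.inl k)
    · exact ⟨(h v hv).hasDerivAt, fun h' => absurd hv h'⟩
    · have hv' := M.mem_ch.not.mp hv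
      simp only [M.q_update_of_ne (s := Sum.inl k) (w := v) (by simp) hv']
      simpa using hasDerivAt_const _ _
  have hprod := HasDerivAt.fun_finsetProd (u := Finset.univ) fun v _ => (hq v).1
  refine hprod.congr_deriv ?_
  simp only [Function.update_eq_self, smul_eq_mul]
  rw [← Finset.sum_subset (Finset.subset_univ (M.ch (Sum.inl k)))]
  · exact Finset.sum_congr rfl fun v _ => mul_comm _ _
  · intro v _ hv
    rw [(hq v).2 hv, mul_zero]

end GraphicalModel

theorem theorem3 {V K : Type*} [Fintype V] [DecidableEq V] [DecidableEq K]
    (M : GraphicalModel V K) (f : (V → ℝ) → ℝ) (φ : K → ℝ) (k : K)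
    (hφ : φ ∈ M.Θ) (hφk : ∀ᶠ t in 𝓝 (φ k), Function.update φ k t ∈ M.Θ)
    (hnabla : M.HasNablas φ k) (hf : M.Admissible f φ k) :
    Integrable (fun z => ∑ v ∈ M.ch (Sum.inl k),
        M.nabla (Sum.inl k) v (Sum.elim φ z) * M.BP f φ z v) (M.law φ) ∧
      HasDerivAt (fun t => ∫ z, f z ∂(M.law (Function.update φ k t)))
        (∫ z, ∑ v ∈ M.ch (Sum.inl k),
          M.nabla (Sum.inl k) v (Sum.elim φ z) * M.BP f φ z v ∂(M.law φ)) (φ k) := by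
  have hpath : ∀ v ∈ M.ch (Sum.inl k), M.IsPath k [v] := fun v hv => ⟨M.mem_ch.mp hv, trivial⟩
  have hBP : ∀ v ∈ M.ch (Sum.inl k),
      Integrable (fun z => M.nabla (Sum.inl k) v (Sum.elim φ z) * M.BP f φ z v) (M.law φ) ∧
      ∫ z, M.score f φ k [] v z ∂M.base =
        ∫ z, M.nabla (Sum.inl k) v (Sum.elim φ z) * M.BP f φ z v ∂M.law φ := fun v hv => by
    simpa [GraphicalModel.pathNabla, GraphicalModel.tip] using
      M.integral_score_eq_integral_BP hφ hφk hnabla hf v [] (hpath v hv)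
  have hscore : ∀ v ∈ M.ch (Sum.inl k), Integrable (M.score f φ k [] v) M.base :=
    fun v hv => hf.integrable_score [] v (hpath v hv)
  refine ⟨integrable_finsetSum _ fun v hv => (hBP v hv).1, ?_⟩
  rw [integral_finsetSum _ fun v hv => (hBP v hv).1,
    ← Finset.sum_congr rfl fun v hv => (hBP v hv).2, ← integral_finsetSum _ hscore]
  obtain ⟨ε, hε, b, hb, hlip⟩ := hf.dominated
  have hdiff := (ae_ball_iff (M.ch (Sum.inl k)).countable_toSet).mpr fun v hv =>
    hnabla.differentiable_density [] v (hpath v hv)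
  have hderiv := (hasDerivAt_integral_of_dominated_loc_of_lip (μ := M.base)
    (F := fun t z => f z * M.density (Function.update φ k t) z)
    (F' := fun z => ∑ v ∈ M.ch (Sum.inl k), M.score f φ k [] v z)
    (Metric.ball_mem_nhds (φ k) hε) ?_ ?_
    (integrable_finsetSum _ hscore).aestronglyMeasurable hlip hb ?_).2
  -- The expectation equals an integral against the fixed base measure at admissible parameters,
  -- hence near `φ k`.
  · refine hderiv.congr_of_eventuallyEq ?_
    filter_upwards [hφk] with t ht using M.integral_law ht f
  · filter_upwards [hφk] with t ht
    exact (hf.measurable.mul (M.measurable_density ht)).aestronglyMeasurable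
  · simpa only [Function.update_eq_self] using (M.integrable_law_iff hφ).mp hf.integrable
  · filter_upwards [hdiff] with z hz
    refine ((M.hasDerivAt_density hz).const_mul (f z)).congr_deriv ?_
    simp only [GraphicalModel.score, GraphicalModel.pathNabla, GraphicalModel.tip, mul_one,
      Finset.mul_sum]
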